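/- Let $d \in \mathbb{N} \cup \{\infty\}$ and let $\mathbb{B}_d$ be the open Euclidean unit ball of $\mathbb{C}^d$, where $\mathbb{C}^\infty := \ell^2$. Let $\gamma \in (0,\infty)$, and let $\mathcal{H}_\gamma$ be the reproducing kernel Hilbert space of functions on $\mathbb{B}_d$ with kernel $$K(z,w) = \frac{1}{(1 - \langle z,w\rangle)^\gamma} \qquad (z,w \in \mathbb{B}_d),$$ where the power is taken with the principal branch. Let $\phi : \mathbb{B}_d \to \mathbb{B}_d$ and $\delta : \mathbb{B}_d \to \mathbb{C}$ be arbitrary mappings, and consider the weighted composition operator $W_{\delta,\phi} : f \mapsto \delta \cdot (f \circ \phi)$. The following are equivalent: (i) $W_{\delta,\phi}$ is a well-defined unitary operator on $\mathcal{H}_\gamma$, that is, it maps $\mathcal{H}_\gamma$ to itself and is unitary; (ii) $\phi \in \operatorname{Aut}(\mathbb{B}_d)$, i.e. $\phi$ is a holomorphic bijection of $\mathbb{B}_d$ onto itself with holomorphic inverse, and, with $a = \phi^{-1}(0)$, there is $\mu \in \mathbb{C}$ with $|\mu| = 1$ such that $$\delta(z) = \mu\, \frac{K(z,a)}{K(a,a)^{1/2}}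 \qquad \text{for all } z \in \mathbb{B}_d.$$ -/

import Mathlib

/-- The space `ℂ^d` for `d ∈ ℕ ∪ {∞}`: square-summable families of complex numbers indexed by the
natural numbers `i < d`, with the Euclidean (`ℓ²`) norm. For finite `d` this is the Euclidean space
of dimension `d`; for `d = ∞` (written `⊤`) it is `ℓ²`. -/
abbrev CSpace (d : ℕ∞) : Type :=
  lp (fun _ : {i : ℕ // (i : ℕ∞) < d} => ℂ) 2

section Ball

open scoped ComplexOrder InnerProductSpace

variable (E : Type*) [NormedAddCommGroup E] [InnerProductSpace ℂ E]

/-- The open unit ball, as a type. -/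
abbrev UnitBall : Type _ := Metric.ball (0 : E) 1

/-- The centre of the unit ball. -/
def UnitBall.origin : UnitBall E := ⟨0, by simp⟩

variable {E}

/-- A self-map of the unit ball is holomorphic if it is complex (Fréchet) differentiable at every
point of the ball. -/
def IsHolomorphicSelfMap (φ : UnitBall E → UnitBall E) : Prop :=
  ∃ F : E → E, DifferentiableOn ℂ F (Metric.ball (0 : E) 1) ∧ ∀ z : UnitBall E, F z = φ z

variable (E) in
/-- `Aut(𝔹)`: the holomorphic bijections of the unit ball onto itself with holomorphic inverse. -/
def biholAut : Set (UnitBall E ≃ UnitBall E) :=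
  {Φ | IsHolomorphicSelfMap Φ ∧ IsHolomorphicSelfMap Φ.symm}

/-- The kernel `K(z, w) = 1 / (1 - ⟨z, w⟩) ^ γ`, with the principal branch of the power. The inner
product `⟨z, w⟩`, linear in `z`, is `⟪w, z⟫_ℂ` in Mathlib's convention. -/
noncomputable def gammaKernel (γ : Set.Ioi (0 : ℝ)) (z w : UnitBall E) : ℂ :=
  1 / (1 - ⟪(w : E), (z : E)⟫_ℂ) ^ ((γ : ℝ) : ℂ)

variable (E) in
/-- The kernel as a matrix of operators on `ℂ` (multiplication by its values), which is the form
in which Mathlib's construction of a reproducing kernel Hilbert space takes it. -/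
noncomputable def gammaMatrix (γ : Set.Ioi (0 : ℝ)) :
    Matrix (UnitBall E) (UnitBall E) (ℂ →L[ℂ] ℂ) :=
  .of fun z w => gammaKernel γ z w • ContinuousLinearMap.id ℂ ℂ

lemma gammaKernel_hasSum (γ : Set.Ioi (0 : ℝ)) (z w : UnitBall E) :
    HasSum (fun n : ℕ => ((Ring.choose ((γ : ℝ) + n - 1) n : ℝ) : ℂ) * ⟪(w : E), (z : E)⟫_ℂ ^ n)
      (gammaKernel γ z w) := by
  have hz : ‖(z : E)‖ < 1 := mem_ball_zero_iff.mp z.2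
  have hw : ‖(w : E)‖ < 1 := mem_ball_zero_iff.mp w.2
  have h1 : ‖⟪(w : E), (z : E)⟫_ℂ‖ < 1 :=
    (norm_inner_le_norm _ _).trans_lt (by nlinarith [norm_nonneg (z : E), norm_nonneg (w : E)])
  have h := (Complex.one_div_one_sub_cpow_hasFPowerSeriesOnBall_zero ((γ : ℝ) : ℂ)).hasSum
    (y := ⟪(w : E), (z : E)⟫_ℂ) (by
      rw [← ENNReal.ofReal_one, Metric.eball_ofReal]
      simpa using h1)
  rw [zero_add] at h
  have e : ∀ n : ℕ, ((Ring.choose ((γ : ℝ) + n - 1) n : ℝ) : ℂ) =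
      Ring.choose (((γ : ℝ) : ℂ) + n - 1) n := fun n => by
    rw [Complex.ofReal_choose]
    push_cast
    rfl
  simp_rw [e]
  simpa only [gammaKernel, FormalMultilinearSeries.ofScalars_apply_eq, smul_eq_mul] using h

lemma gammaKernel_coeff_nonneg (γ : Set.Ioi (0 : ℝ)) (n : ℕ) :
    0 ≤ Ring.choose ((γ : ℝ) + n - 1) n := by
  have hγ : 0 < (γ : ℝ) := γ.2
  have h := Ring.factorial_nsmul_multichoose_eq_ascPochhammer (γ : ℝ) n
  rw [Polynomial.ascPochhammer_smeval_eq_eval] at h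
  have hp := ascPochhammer_pos n (γ : ℝ) hγ
  rw [← h, nsmul_eq_mul] at hp
  have : 0 < Ring.multichoose (γ : ℝ) n := pos_of_mul_pos_right hp (by positivity)
  rw [Ring.choose]
  rw [show (γ : ℝ) + n - 1 - n + 1 = γ by ring]
  exact this.le

lemma posSemidef_inner {X F : Type*} [NormedAddCommGroup F] [InnerProductSpace ℂ F] (v : X → F) :
    (Matrix.of fun i j => ⟪v j, v i⟫_ℂ).PosSemidef := by
  refine ⟨?_, fun x => ?_⟩
  · ext i j
    simp
  · have : (x.sum fun i xi => x.sum fun j xj => star xi * ⟪v j, v i⟫_ℂ * xj) =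
        ⟪x.sum fun i xi => star xi • v i, x.sum fun i xi => star xi • v i⟫_ℂ := by
      simp only [Finsupp.sum, sum_inner, inner_sum, inner_smul_left, inner_smul_right,
        Finset.mul_sum]
      refine Finset.sum_congr rfl fun i _ => Finset.sum_congr rfl fun j _ => ?_
      simp
      ring
    simp only [Matrix.of_apply]
    rw [this, inner_self_eq_norm_sq_to_K]
    rw [← RCLike.ofReal_pow]
    exact Complex.zero_le_real.mpr (sq_nonneg _)

lemma gammaKernel_posSemidef (γ : Set.Ioi (0 : ℝ)) :
    (Matrix.of (gammaKernel (E := E) γ)).PosSemidef := by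
  have hpow : ∀ n : ℕ, (Matrix.of fun z w : UnitBall E => ⟪(w : E), (z : E)⟫_ℂ ^ n).PosSemidef := by
    intro n
    induction n with
    | zero =>
      have h := posSemidef_inner (fun _ : UnitBall E => (1 : ℂ))
      simpa using h
    | succ n ih =>
      have h : ((Matrix.of fun z w : UnitBall E => ⟪(w : E), (z : E)⟫_ℂ ^ n).hadamard
        (Matrix.of fun z w : UnitBall E => ⟪(w : E), (z : E)⟫_ℂ)).PosSemidef :=
        Matrix.PosSemidef.hadamard (𝕜 := ℂ) ih (posSemidef_inner fun z : UnitBall E => (z : E))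
      have e : (Matrix.of fun z w : UnitBall E => ⟪(w : E), (z : E)⟫_ℂ ^ (n + 1)) =
          (Matrix.of fun z w : UnitBall E => ⟪(w : E), (z : E)⟫_ℂ ^ n).hadamard
          (Matrix.of fun z w : UnitBall E => ⟪(w : E), (z : E)⟫_ℂ) := by
        ext z w
        simp [pow_succ]
      rw [e]
      exact h
  have hpart : ∀ N : ℕ, (∑ n ∈ Finset.range N, Ring.choose ((γ : ℝ) + n - 1) n •
      (Matrix.of fun z w : UnitBall E => ⟪(w : E), (z : E)⟫_ℂ ^ n)).PosSemidef := fun N =>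
    Matrix.posSemidef_sum _ fun n _ => (hpow n).smul (gammaKernel_coeff_nonneg γ n)
  have hlim : ∀ z w : UnitBall E, Filter.Tendsto
      (fun N : ℕ => (∑ n ∈ Finset.range N, Ring.choose ((γ : ℝ) + n - 1) n •
        (Matrix.of fun z w : UnitBall E => ⟪(w : E), (z : E)⟫_ℂ ^ n)) z w) Filter.atTop
      (nhds (gammaKernel γ z w)) := by
    intro z w
    refine (gammaKernel_hasSum γ z w).tendsto_sum_nat.congr fun N => ?_
    simp [Matrix.sum_apply]
  refine ⟨?_, fun x => ?_⟩
  · ext z w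
    refine tendsto_nhds_unique ((hlim w z).star) ((hlim z w).congr fun N => ?_)
    exact ((hpart N).1.apply z w).symm
  · refine ge_of_tendsto' (b := 0) (x := Filter.atTop) ?_ fun N => (hpart N).2 x
    simp only [Finsupp.sum]
    refine tendsto_finsetSum _ fun i _ => tendsto_finsetSum _ fun j _ => ?_
    exact ((hlim i j).const_mul _).mul_const _

instance gammaMatrix_posSemidef (γ : Set.Ioi (0 : ℝ)) :
    Fact (gammaMatrix E γ).PosSemidef := by
  have h := gammaKernel_posSemidef (E := E) γ
  have htfae := (RKHS.posSemidef_tfae (K := gammaMatrix E γ)).out 0 2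
  refine ⟨htfae.mpr ⟨?_, fun x => ?_⟩⟩
  · ext z w
    have hk : star (gammaKernel γ w z) = gammaKernel γ z w := h.1.apply z w
    rw [Matrix.conjTranspose_apply]
    have hid : star (ContinuousLinearMap.id ℂ ℂ) = ContinuousLinearMap.id ℂ ℂ :=
      star_one (ℂ →L[ℂ] ℂ)
    simp [gammaMatrix, star_smul, ← hk, hid]
  · have hx := (Complex.le_def.mp (h.2 x)).1
    have e : (x.sum fun z c => x.sum fun z' c' => ⟪gammaMatrix E γ z' z c, c'⟫_ℂ) =
        star (x.sum fun i xi => x.sum fun j xj => star xi * gammaKernel γ i j * xj) := by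
      simp only [Finsupp.sum, star_sum]
      rw [Finset.sum_comm]
      refine Finset.sum_congr rfl fun i _ => Finset.sum_congr rfl fun j _ => ?_
      simp [gammaMatrix]
      ring
    rw [e]
    simpa only [RCLike.star_def, RCLike.conj_re] using! hx

end Ball

/-- `H_γ`: the reproducing kernel Hilbert space on the unit ball with kernel
`1 / (1 - ⟨z, w⟩) ^ γ`. -/
abbrev HGamma (E : Type*) [NormedAddCommGroup E] [InnerProductSpace ℂ E]
    (γ : Set.Ioi (0 : ℝ)) : Type _ :=
  RKHS.OfKernel (gammaMatrix E γ)

/-- The weighted composition operator `f ↦ δ · (f ∘ φ)` is well defined as a map from `H` to itself,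
and is a unitary operator on `H`. -/
def IsUnitaryWCO {X : Type*} (H : Type*) [NormedAddCommGroup H] [InnerProductSpace ℂ H]
    [CompleteSpace H] [RKHS ℂ H X ℂ] (δ : X → ℂ) (φ : X → X) : Prop :=
  ∃ W : H →L[ℂ] H, (∀ (f : H) (x : X), W f x = δ x * f (φ x)) ∧ W ∈ unitary (H →L[ℂ] H)

/-! With `k_w` the kernel function at `w`, the adjoint of `W` sends `k_w` to `conj (δ w) • k_{φ w}`.
So `W W* = 1` gives `K(z,w) = δ(z) conj(δ(w)) K(φ z, φ w)`, and conversely this identity yields a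
unitary when `φ` is onto and `δ` has no zeros.

From (ii) to (i): the Möbius involution exchanging `0` and `a = Φ⁻¹(0)` satisfies the identity with
weight `K(z,a)/K(a,a)^(1/2)`. Composing it with `Φ` gives an automorphism fixing `0`, which
preserves inner products by Cartan's theorem, so `Φ` satisfies the same identity.

From (i) to (ii): follow `φ` by the involution moving `φ 0` to `0`. The resulting `ψ` fixes `0`, and
`K(z,0) = 1` makes its weight a unimodular constant, so `ψ` preserves `K`. Moduli show that `ψ` is
continuous; connectedness of the ball then removes the ambiguity of the `γ`-th power, so `ψ`
preserves inner products (`inner_map_of_gammaKernel_map`). Injectivity of `W` makes the range of `ψ`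
total, so `ψ` is the restriction of a unitary of `E`. The weight is read off from the kernel
identity at `w = a`. -/

open scoped InnerProductSpace ComplexConjugate

/-! ### Unitaries from Gram matrices -/

section HilbertSpace

variable {ι H : Type*} [NormedAddCommGroup H] [InnerProductSpace ℂ H] [CompleteSpace H]

lemma denseRange_linearCombination_of_orthogonal (u : ι → H)
    (hu : ∀ x, (∀ i, ⟪u i, x⟫_ℂ = 0) → x = 0) :
    DenseRange (Finsupp.linearCombination ℂ u) := by
  have h : (Submodule.span ℂ (Set.range u)).topologicalClosure = ⊤ := by
    rw [Submodule.topologicalClosure_eq_top_iff, Submodule.eq_bot_iff]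
    intro x hx
    refine hu x fun i => ?_
    exact (Submodule.mem_orthogonal _ x).1 hx _ (Submodule.subset_span ⟨i, rfl⟩)
  have h2 := Submodule.dense_iff_topologicalClosure_eq_top.2 h
  rw [← Finsupp.range_linearCombination] at h2
  exact h2

/-- Two total families of vectors with the same Gram matrix are related by a unitary. -/
lemma exists_linearIsometryEquiv_of_gram_eq (u v : ι → H)
    (hu : ∀ x, (∀ i, ⟪u i, x⟫_ℂ = 0) → x = 0) (hv : ∀ x, (∀ i, ⟪v i, x⟫_ℂ = 0) → x = 0)
    (h : ∀ i j, ⟪u i, u j⟫_ℂ = ⟪v i, v j⟫_ℂ) :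
    ∃ U : H ≃ₗᵢ[ℂ] H, ∀ i, U (u i) = v i := by
  -- The Gram matrix determines the norm of every finite combination, so `u i ↦ v i` extends
  -- isometrically.
  have hn : ∀ x : ι →₀ ℂ, ‖Finsupp.linearCombination ℂ v x‖ = ‖Finsupp.linearCombination ℂ u x‖ := by
    intro x
    have : ⟪Finsupp.linearCombination ℂ v x, Finsupp.linearCombination ℂ v x⟫_ℂ =
        ⟪Finsupp.linearCombination ℂ u x, Finsupp.linearCombination ℂ u x⟫_ℂ := by
      simp only [Finsupp.linearCombination_apply, Finsupp.sum, sum_inner, inner_sum,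
        inner_smul_left, inner_smul_right, h]
    rw [inner_self_eq_norm_sq_to_K, inner_self_eq_norm_sq_to_K] at this
    have h2 : ‖Finsupp.linearCombination ℂ v x‖ ^ 2 = ‖Finsupp.linearCombination ℂ u x‖ ^ 2 := by
      exact_mod_cast this
    exact (sq_eq_sq₀ (norm_nonneg _) (norm_nonneg _)).1 h2
  refine ⟨(LinearEquiv.refl ℂ (ι →₀ ℂ)).extendOfIsometry _ _
    (denseRange_linearCombination_of_orthogonal u hu)
    (denseRange_linearCombination_of_orthogonal v hv) hn, fun i => ?_⟩
  have := LinearEquiv.extendOfIsometry_eq (LinearEquiv.refl ℂ (ι →₀ ℂ)) _ _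
    (denseRange_linearCombination_of_orthogonal u hu)
    (denseRange_linearCombination_of_orthogonal v hv) hn (Finsupp.single i 1)
  simpa using this

end HilbertSpace

/-! ### Unitary weighted composition operators and the kernel identity -/

section WeightedComposition

variable {X H : Type*} [NormedAddCommGroup H] [InnerProductSpace ℂ H] [CompleteSpace H]
  [RKHS ℂ H X ℂ]

lemma RKHS.inner_kerFun_one (f : H) (x : X) : ⟪RKHS.kerFun H x (1 : ℂ), f⟫_ℂ = f x := by
  simp

lemma RKHS.kerFun_one_apply (x y : X) : RKHS.kerFun H y (1 : ℂ) x = RKHS.kernel H x y 1 :=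
  RKHS.kerFun_apply H y 1 x

lemma adjoint_wco_kerFun {δ : X → ℂ} {φ : X → X} {W : H →L[ℂ] H}
    (hW : ∀ (f : H) (x : X), W f x = δ x * f (φ x)) (w : X) :
    ContinuousLinearMap.adjoint W (RKHS.kerFun H w (1 : ℂ)) =
      conj (δ w) • RKHS.kerFun H (φ w) (1 : ℂ) := by
  refine ext_inner_right ℂ fun f => ?_
  rw [ContinuousLinearMap.adjoint_inner_left, inner_smul_left, RKHS.inner_kerFun_one,
    RKHS.inner_kerFun_one, hW]
  simp

/-- Evaluate `W W* k_w = k_w` at `z`. -/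
lemma kernel_eq_of_isUnitaryWCO {δ : X → ℂ} {φ : X → X} (h : IsUnitaryWCO H δ φ) (z w : X) :
    RKHS.kernel H z w 1 = δ z * conj (δ w) * RKHS.kernel H (φ z) (φ w) 1 := by
  obtain ⟨W, hW, hu⟩ := h
  have h1 : W (ContinuousLinearMap.adjoint W (RKHS.kerFun H w (1 : ℂ))) =
      RKHS.kerFun H w (1 : ℂ) := by
    have := (Unitary.mem_iff.1 hu).2
    rw [ContinuousLinearMap.star_eq_adjoint] at this
    exact congrArg (fun T : H →L[ℂ] H => T (RKHS.kerFun H w (1 : ℂ))) this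
  rw [← RKHS.kerFun_one_apply, ← h1, hW, adjoint_wco_kerFun hW, ← RKHS.kerFun_one_apply]
  simp
  ring

/-- Such an `f` is killed by `W`, which is injective. This replaces surjectivity of `φ`, not yet
known when it is applied. -/
lemma eq_zero_of_isUnitaryWCO {δ : X → ℂ} {φ : X → X} (h : IsUnitaryWCO H δ φ) (f : H)
    (hf : ∀ x, f (φ x) = 0) : f = 0 := by
  obtain ⟨W, hW, hu⟩ := h
  have h1 : ContinuousLinearMap.adjoint W (W f) = f := by
    have := (Unitary.mem_iff.1 hu).1
    rw [ContinuousLinearMap.star_eq_adjoint] at this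
    exact congrArg (fun T : H →L[ℂ] H => T f) this
  have h2 : W f = 0 := by
    ext x
    simp [hW, hf]
  rw [← h1, h2, map_zero]

/-- The hypothesis says that `k_w` and `conj (δ w) • k_{φ w}` have equal Gram matrices; surjectivity
and `δ ≠ 0` make the second family total. The unitary between them is `W*`, so its inverse is taken
as `W`. -/
lemma isUnitaryWCO_of_kernel_eq {δ : X → ℂ} {φ : X → X} (hφ : Function.Surjective φ)
    (hδ : ∀ x, δ x ≠ 0)
    (h : ∀ z w, RKHS.kernel H z w 1 = δ z * conj (δ w) * RKHS.kernel H (φ z) (φ w) 1) :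
    IsUnitaryWCO H δ φ := by
  obtain ⟨U, hU⟩ := exists_linearIsometryEquiv_of_gram_eq (H := H)
    (fun w : X => RKHS.kerFun H w (1 : ℂ))
    (fun w : X => conj (δ w) • RKHS.kerFun H (φ w) (1 : ℂ))
    (fun f hf => RKHS.ext fun x => by
      rw [← RKHS.inner_kerFun_one, hf]; simp)
    (fun f hf => RKHS.ext fun x => by
      obtain ⟨y, rfl⟩ := hφ x
      have := hf y
      rw [inner_smul_left, RKHS.inner_kerFun_one] at this
      simpa [hδ y] using this)
    (fun z w => by
      rw [inner_smul_left, inner_smul_right, RKHS.inner_kerFun_one, RKHS.inner_kerFun_one,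
        RKHS.kerFun_one_apply, RKHS.kerFun_one_apply, h]
      simp
      ring)
  refine ⟨(U.symm : H →L[ℂ] H), fun f x => ?_, ?_⟩
  · rw [← RKHS.inner_kerFun_one]
    change ⟪_, U.symm f⟫_ℂ = _
    rw [← U.inner_map_map, U.apply_symm_apply, hU, inner_smul_left, RKHS.inner_kerFun_one]
    simp
  · rw [Unitary.mem_iff, ContinuousLinearMap.star_eq_adjoint]
    have : ContinuousLinearMap.adjoint (U.symm : H →L[ℂ] H) = (U : H →L[ℂ] H) := by
      have := LinearIsometryEquiv.adjoint_eq_symm U.symm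
      simpa using this
    rw [this]
    constructor <;> ext1 f <;> simp

end WeightedComposition

/-! ### Möbius involutions of the ball -/

section Mobius

variable {E : Type*} [NormedAddCommGroup E]

/-- The defect `√(1 - ‖a‖²)` of a point of the ball. -/
noncomputable def ballDefect (a : E) : ℝ := √(1 - ‖a‖ ^ 2)

lemma ballDefect_pos {a : E} (ha : ‖a‖ < 1) : 0 < ballDefect a :=
  Real.sqrt_pos.2 (by nlinarith [norm_nonneg a])

lemma one_add_ballDefect_ne_zero {a : E} (ha : ‖a‖ < 1) : (1 + ballDefect a : ℂ) ≠ 0 := by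
  have := ballDefect_pos ha
  exact_mod_cast (by positivity : (1 + ballDefect a) ≠ 0)

variable [InnerProductSpace ℂ E]

lemma norm_inner_lt_one {z w : E} (hz : ‖z‖ < 1) (hw : ‖w‖ < 1) : ‖⟪w, z⟫_ℂ‖ < 1 :=
  (norm_inner_le_norm _ _).trans_lt (by nlinarith [norm_nonneg z, norm_nonneg w])

lemma re_one_sub_inner_pos {z w : E} (hz : ‖z‖ < 1) (hw : ‖w‖ < 1) :
    0 < (1 - ⟪w, z⟫_ℂ).re := by
  have := (Complex.re_le_norm _).trans_lt (norm_inner_lt_one hz hw)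
  simpa using this

lemma one_sub_inner_ne_zero {z w : E} (hz : ‖z‖ < 1) (hw : ‖w‖ < 1) : 1 - ⟪w, z⟫_ℂ ≠ 0 := by
  intro h
  have := re_one_sub_inner_pos hz hw
  simp [h] at this

lemma inner_self_eq_one_sub_ballDefect_sq {a : E} (ha : ‖a‖ < 1) :
    ⟪a, a⟫_ℂ = 1 - (ballDefect a : ℂ) ^ 2 := by
  have h : ballDefect a ^ 2 = 1 - ‖a‖ ^ 2 := Real.sq_sqrt (by nlinarith [norm_nonneg a])
  rw [inner_self_eq_norm_sq_to_K, ← Complex.ofReal_pow, h]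
  simp

/-- The involutive automorphism of the unit ball of a Hilbert space that exchanges `0` and `a`. -/
noncomputable def ballMobius (a z : E) : E :=
  (1 - ⟪a, z⟫_ℂ)⁻¹ • (a - (ballDefect a : ℂ) • z - (⟪a, z⟫_ℂ / (1 + ballDefect a)) • a)

/-- Pure algebra once `‖a‖² = 1 - s²`, where `s` is the defect. The map uses `s z + ⟨z,a⟩/(1+s) a`
for the usual `P z + s (z - P z)`, `P` being the projection onto `ℂ a`; no division by `‖a‖²`
occurs, so `a = 0` is not special. -/
lemma one_sub_inner_ballMobius {a z w : E} (ha : ‖a‖ < 1) (hz : ‖z‖ < 1) (hw : ‖w‖ < 1) :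
    (1 - ⟪ballMobius a w, ballMobius a z⟫_ℂ) * (1 - ⟪a, z⟫_ℂ) * (1 - ⟪w, a⟫_ℂ) =
      (ballDefect a : ℂ) ^ 2 * (1 - ⟪w, z⟫_ℂ) := by
  have h1 := one_sub_inner_ne_zero hz ha
  have h2 := one_sub_inner_ne_zero ha hw
  have h3 := one_add_ballDefect_ne_zero ha
  have hc : conj ⟪a, w⟫_ℂ = ⟪w, a⟫_ℂ := inner_conj_symm w a
  simp only [ballMobius, inner_smul_left, inner_smul_right, inner_sub_left, inner_sub_right,
    inner_self_eq_one_sub_ballDefect_sq ha, map_inv₀, map_sub, map_one, map_div₀, map_add, hc,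
    Complex.conj_ofReal]
  field_simp
  ring

/-- The case `w = 0` of the previous identity; it gives the denominator in the second application of
the involution. -/
lemma one_sub_inner_ballMobius_right {a z : E} (ha : ‖a‖ < 1) (hz : ‖z‖ < 1) :
    (1 - ⟪a, ballMobius a z⟫_ℂ) * (1 - ⟪a, z⟫_ℂ) = (ballDefect a : ℂ) ^ 2 := by
  have h1 := one_sub_inner_ne_zero hz ha
  have h3 := one_add_ballDefect_ne_zero ha
  simp only [ballMobius, inner_smul_right, inner_sub_right, inner_self_eq_one_sub_ballDefect_sq ha]
  field_simp
  ring

lemma ballMobius_zero (a : E) : ballMobius a 0 = a := by simp [ballMobius]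

lemma ballMobius_self {a : E} (ha : ‖a‖ < 1) : ballMobius a a = 0 := by
  have h3 := one_add_ballDefect_ne_zero ha
  have : (1 - (ballDefect a : ℂ) - ⟪a, a⟫_ℂ / (1 + ballDefect a)) = 0 := by
    rw [inner_self_eq_one_sub_ballDefect_sq ha]
    field_simp
    ring
  have e : a - (ballDefect a : ℂ) • a - (⟪a, a⟫_ℂ / (1 + ballDefect a)) • a =
    (1 - (ballDefect a : ℂ) - ⟪a, a⟫_ℂ / (1 + ballDefect a)) • a := by module
  rw [ballMobius, e, this, zero_smul, smul_zero]

/-- On the diagonal the identity expresses `1 - ‖ballMobius a z‖²` as a positive multiple of `1 -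
‖z‖²`. -/
lemma norm_ballMobius_lt_one {a z : E} (ha : ‖a‖ < 1) (hz : ‖z‖ < 1) : ‖ballMobius a z‖ < 1 := by
  have h := one_sub_inner_ballMobius ha hz hz
  have h1 := one_sub_inner_ne_zero hz ha
  have hc : 1 - ⟪z, a⟫_ℂ = conj (1 - ⟪a, z⟫_ℂ) := by simp
  rw [hc, mul_assoc, Complex.mul_conj, inner_self_eq_norm_sq_to_K, inner_self_eq_norm_sq_to_K] at h
  have h' : (1 - ‖ballMobius a z‖ ^ 2) * Complex.normSq (1 - ⟪a, z⟫_ℂ) =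
      ballDefect a ^ 2 * (1 - ‖z‖ ^ 2) := by
    apply Complex.ofReal_injective
    simpa using h
  have hp : 0 < ballDefect a ^ 2 * (1 - ‖z‖ ^ 2) :=
    mul_pos (pow_pos (ballDefect_pos ha) 2) (by nlinarith [norm_nonneg z])
  rw [← h'] at hp
  have := pos_of_mul_pos_left hp (Complex.normSq_nonneg _)
  nlinarith [norm_nonneg (ballMobius a z)]

lemma ballMobius_ballMobius {a z : E} (ha : ‖a‖ < 1) (hz : ‖z‖ < 1) :
    ballMobius a (ballMobius a z) = z := by
  have h1 := one_sub_inner_ne_zero hz ha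
  have h3 := one_add_ballDefect_ne_zero ha
  have hs : (ballDefect a : ℂ) ≠ 0 := by exact_mod_cast (ballDefect_pos ha).ne'
  have h4 : 1 - ⟪a, ballMobius a z⟫_ℂ = (ballDefect a : ℂ) ^ 2 / (1 - ⟪a, z⟫_ℂ) :=
    eq_div_of_mul_eq h1 (one_sub_inner_ballMobius_right ha hz)
  have h5 : ⟪a, ballMobius a z⟫_ℂ = 1 - (ballDefect a : ℂ) ^ 2 / (1 - ⟪a, z⟫_ℂ) := by
    rw [← h4]; ring
  rw [ballMobius, h4, h5, ballMobius]
  match_scalars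
  · field_simp
    ring
  · field_simp

lemma differentiableOn_ballMobius {a : E} (ha : ‖a‖ < 1) :
    DifferentiableOn ℂ (ballMobius a) (Metric.ball 0 1) := by
  intro z hz
  have h1 := one_sub_inner_ne_zero (mem_ball_zero_iff.1 hz) ha
  have hd : DifferentiableAt ℂ (fun z => ⟪a, z⟫_ℂ) z := (innerSL ℂ a).differentiableAt
  refine DifferentiableAt.differentiableWithinAt ?_
  unfold ballMobius
  simp only [div_eq_mul_inv]
  exact ((hd.const_sub 1).inv h1).smul
    (((differentiableAt_id.const_smul _).const_sub a).sub ((hd.mul_const _).smul_const a))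

/-- `ballMobius` as a permutation of the unit ball. -/
noncomputable def mobiusPerm (a : UnitBall E) : UnitBall E ≃ UnitBall E :=
  Function.Involutive.toPerm
    (fun z => ⟨ballMobius a z, mem_ball_zero_iff.2
      (norm_ballMobius_lt_one (mem_ball_zero_iff.1 a.2) (mem_ball_zero_iff.1 z.2))⟩)
    fun z => Subtype.ext (ballMobius_ballMobius (mem_ball_zero_iff.1 a.2) (mem_ball_zero_iff.1 z.2))

lemma mobiusPerm_symm (a : UnitBall E) : (mobiusPerm a).symm = mobiusPerm a :=
  Function.Involutive.toPerm_symm _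

lemma mobiusPerm_mobiusPerm (a z : UnitBall E) : mobiusPerm a (mobiusPerm a z) = z := by
  conv_lhs => rw [← mobiusPerm_symm a]
  rw [mobiusPerm_symm a]
  exact (mobiusPerm a).symm_apply_apply z

lemma mobiusPerm_self (a : UnitBall E) : mobiusPerm a a = UnitBall.origin E :=
  Subtype.ext (ballMobius_self (mem_ball_zero_iff.1 a.2))

lemma mobiusPerm_origin (a : UnitBall E) : mobiusPerm a (UnitBall.origin E) = a :=
  Subtype.ext (ballMobius_zero (a : E))

lemma isHolomorphicSelfMap_mobiusPerm (a : UnitBall E) : IsHolomorphicSelfMap (mobiusPerm a) :=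
  ⟨ballMobius (a : E), differentiableOn_ballMobius (mem_ball_zero_iff.1 a.2), fun _ => rfl⟩

lemma IsHolomorphicSelfMap.comp {f g : UnitBall E → UnitBall E} (hf : IsHolomorphicSelfMap f)
    (hg : IsHolomorphicSelfMap g) : IsHolomorphicSelfMap (f ∘ g) := by
  obtain ⟨F, hF, hFf⟩ := hf
  obtain ⟨G, hG, hGg⟩ := hg
  refine ⟨F ∘ G, hF.comp hG fun z hz => ?_, fun z => ?_⟩
  · rw [hGg ⟨z, hz⟩]
    exact (g ⟨z, hz⟩).2
  · simp [hGg, hFf]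

end Mobius

/-! ### Schwarz lemma and Cartan's theorem -/

section Cartan

variable {E : Type*} [NormedAddCommGroup E] [InnerProductSpace ℂ E]

lemma IsHolomorphicSelfMap.norm_le {ψ : UnitBall E → UnitBall E} (h : IsHolomorphicSelfMap ψ)
    (h0 : ψ (UnitBall.origin E) = UnitBall.origin E) (z : UnitBall E) : ‖(ψ z : E)‖ ≤ ‖(z : E)‖ := by
  obtain ⟨F, hF, hFψ⟩ := h
  rw [← hFψ]
  refine Complex.norm_le_norm_of_mapsTo_ball hF (fun w hw => ?_) ?_ (mem_ball_zero_iff.1 z.2)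
  · rw [hFψ ⟨w, hw⟩]
    exact Metric.ball_subset_closedBall (ψ ⟨w, hw⟩).2
  · exact (hFψ (UnitBall.origin E)).trans (congrArg Subtype.val h0)

/-- A norm-preserving holomorphic map on the unit ball is given by its derivative at the centre. -/
lemma eq_fderiv_of_norm_map {F : E → E} (hF : DifferentiableOn ℂ F (Metric.ball 0 1))
    (hn : ∀ z, ‖z‖ < 1 → ‖F z‖ = ‖z‖) {z : E} (hz : ‖z‖ < 1) : F z = fderiv ℂ F 0 z := by
  have hF0 : F 0 = 0 := by simpa using hn 0 (by simp)
  rcases eq_or_ne z 0 with rfl | hz0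
  · simp [hF0]
  have hzn : ‖z‖ ≠ 0 := norm_ne_zero_iff.2 hz0
  -- Restrict to the complex line through `z`: the one-variable map `g` attains equality in the
  -- Schwarz lemma at `‖z‖`.
  set u : E := (‖z‖⁻¹ : ℂ) • z with hu
  have hun : ‖u‖ = 1 := by simp [hu, norm_smul, hzn]
  have hzu : z = (‖z‖ : ℂ) • u := by
    rw [hu, smul_smul, mul_inv_cancel₀ (by exact_mod_cast hzn), one_smul]
  set g : ℂ → E := fun c => F (c • u) with hg
  have hg0 : g 0 = 0 := by simp [hg, hF0]
  have hmem : ∀ c ∈ Metric.ball (0 : ℂ) 1, c • u ∈ Metric.ball (0 : E) 1 := by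
    intro c hc
    simpa [norm_smul, hun] using hc
  have hgd : DifferentiableOn ℂ g (Metric.ball 0 1) :=
    hF.comp (by fun_prop) hmem
  have hmaps : Set.MapsTo g (Metric.ball 0 1) (Metric.closedBall (g 0) 1) := by
    intro c hc
    have := hmem c hc
    rw [hg0, mem_closedBall_zero_iff, hg]
    simp only
    rw [hn _ (mem_ball_zero_iff.1 this)]
    exact (mem_ball_zero_iff.1 this).le
  have hzb : (‖z‖ : ℂ) ∈ Metric.ball (0 : ℂ) 1 := by simpa using hz
  have hgz : g (‖z‖ : ℂ) = F z := by rw [hg]; simp only; rw [← hzu]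
  have hds : dslope g 0 (‖z‖ : ℂ) = (‖z‖⁻¹ : ℂ) • F z := by
    rw [dslope_of_ne _ (by exact_mod_cast hzn), slope_def_module, hg0, hgz]
    simp
  -- Strict convexity is what makes equality in the vector-valued Schwarz lemma force `g` to be
  -- affine.
  have : StrictConvexSpace ℝ E := by
    let _ : InnerProductSpace ℝ E := InnerProductSpace.complexToReal
    infer_instance
  have haff := Complex.affine_of_mapsTo_ball_of_norm_dslope_eq_div hgd hmaps hzb
    (by rw [hds]; simp [norm_smul, hn z hz, hzn])
  set C := dslope g 0 (‖z‖ : ℂ)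
  have hd1 : HasDerivAt g (fderiv ℂ F 0 u) 0 := by
    have h1 : HasFDerivAt F (fderiv ℂ F 0) ((0 : ℂ) • u) := by
      rw [zero_smul]
      exact (hF.differentiableAt (Metric.ball_mem_nhds 0 one_pos)).hasFDerivAt
    have h2 : HasDerivAt (fun c : ℂ => c • u) u 0 := by
      simpa using (hasDerivAt_id (0 : ℂ)).smul_const u
    exact h1.comp_hasDerivAt (0 : ℂ) h2
  have hd2 : HasDerivAt g C 0 := by
    have h2 : HasDerivAt (fun c : ℂ => g 0 + (c - 0) • C) C 0 := by
      simpa using ((hasDerivAt_id (0 : ℂ)).smul_const C).const_add (g 0)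
    exact h2.congr_of_eventuallyEq
      (haff.eventuallyEq_of_mem (Metric.ball_mem_nhds 0 one_pos))
  have hC := hd1.unique hd2
  rw [← hgz, haff hzb, hg0, ← hC]
  simp only [sub_zero, zero_add]
  rw [← map_smul, ← hzu]

/-- **Cartan's theorem** for the unit ball: an automorphism fixing the centre is the restriction of
a linear isometry, so it preserves inner products. -/
lemma inner_map_of_mem_biholAut {Ψ : UnitBall E ≃ UnitBall E} (h : Ψ ∈ biholAut E)
    (h0 : Ψ (UnitBall.origin E) = UnitBall.origin E) (z w : UnitBall E) :
    ⟪(Ψ w : E), Ψ z⟫_ℂ = ⟪(w : E), z⟫_ℂ := by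
  have h0' : Ψ.symm (UnitBall.origin E) = UnitBall.origin E := by
    rw [Equiv.symm_apply_eq, h0]
  -- Schwarz for `Ψ` and for its inverse.
  have hn : ∀ z : UnitBall E, ‖(Ψ z : E)‖ = ‖(z : E)‖ := fun z =>
    le_antisymm (h.1.norm_le h0 z) (by simpa using h.2.norm_le h0' (Ψ z))
  obtain ⟨F, hF, hFΨ⟩ := h.1
  have hFn : ∀ z, ‖z‖ < 1 → ‖F z‖ = ‖z‖ := fun z hz => by
    rw [hFΨ ⟨z, mem_ball_zero_iff.2 hz⟩, hn]
  have hD : ∀ z : UnitBall E, (Ψ z : E) = fderiv ℂ F 0 z := fun z => by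
    rw [← hFΨ, eq_fderiv_of_norm_map hF hFn (mem_ball_zero_iff.1 z.2)]
  -- Any vector is scaled into the ball by `(1 + ‖z‖)⁻¹`.
  have hiso : ∀ z, ‖fderiv ℂ F 0 z‖ = ‖z‖ := by
    intro z
    have hp : (0 : ℝ) < (1 + ‖z‖)⁻¹ := by positivity
    have hlt : ‖((1 + ‖z‖)⁻¹ : ℝ) • z‖ < 1 := by
      rw [norm_smul, Real.norm_of_nonneg hp.le, inv_mul_lt_one₀ (by positivity)]
      linarith
    have := hFn _ hlt
    rw [eq_fderiv_of_norm_map hF hFn hlt, ContinuousLinearMap.map_smul_of_tower, norm_smul, norm_smul] at this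
    exact mul_left_cancel₀ (by simpa using hp.ne') this
  rw [hD, hD]
  exact LinearIsometry.inner_map_map (⟨(fderiv ℂ F 0).toLinearMap, hiso⟩ : E →ₗᵢ[ℂ] E) w z

end Cartan

/-! ### Principal powers on the right half-plane -/

lemma Complex.eq_zero_of_exp_eq_one_of_abs_im_lt {x : ℂ} (h : Complex.exp x = 1)
    (hx : |x.im| < 2 * Real.pi) : x = 0 := by
  obtain ⟨n, hn⟩ := Complex.exp_eq_one_iff.1 h
  have him : x.im = n * (2 * Real.pi) := by rw [hn]; simp
  rw [him, abs_mul, abs_of_pos Real.two_pi_pos] at hx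
  have h1 : |(n : ℝ)| < 1 := by
    by_contra! hge
    nlinarith [Real.two_pi_pos]
  have h2 : n = 0 := Int.abs_lt_one_iff.1 (by exact_mod_cast h1)
  rw [hn, h2]
  simp

/-- Four arguments, each below `π/2` in modulus, combine to less than `2π`, so the logarithms of the
two sides agree exactly and not only modulo `2πi`. -/
lemma Complex.cpow_mul_cpow_mul_cpow_eq {A B C D : ℂ} (hA : 0 < A.re) (hB : 0 < B.re)
    (hC : 0 < C.re) (hD : 0 < D.re) {r : ℝ} (hr : 0 < r) (h : A * B * C = r * D) (g : ℂ) :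
    A ^ g * B ^ g * C ^ g = (r : ℂ) ^ g * D ^ g := by
  have ne : ∀ {w : ℂ}, 0 < w.re → w ≠ 0 := fun hw h0 => by simp [h0] at hw
  have hr0 : (r : ℂ) ≠ 0 := by exact_mod_cast hr.ne'
  have him : ∀ {w : ℂ}, 0 < w.re → |(Complex.log w).im| < Real.pi / 2 := fun hw => by
    rw [Complex.log_im]
    exact Complex.abs_arg_lt_pi_div_two_iff.2 (Or.inl hw)
  have hlog : Complex.log A + Complex.log B + Complex.log C -
      (Complex.log r + Complex.log D) = 0 := by
    refine Complex.eq_zero_of_exp_eq_one_of_abs_im_lt ?_ ?_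
    · rw [Complex.exp_sub, Complex.exp_add, Complex.exp_add, Complex.exp_add,
        Complex.exp_log (ne hA), Complex.exp_log (ne hB), Complex.exp_log (ne hC),
        Complex.exp_log (ne hD), Complex.exp_log hr0, h]
      exact div_self (mul_ne_zero hr0 (ne hD))
    · have h1 := abs_lt.1 (him hA)
      have h2 := abs_lt.1 (him hB)
      have h3 := abs_lt.1 (him hC)
      have h4 := abs_lt.1 (him hD)
      have h5 : (Complex.log (r : ℂ)).im = 0 := by
        rw [Complex.log_im, Complex.arg_ofReal_of_nonneg hr.le]
      simp only [Complex.sub_im, Complex.add_im, h5]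
      rw [abs_lt]
      constructor <;> linarith [h1.1, h1.2]
  rw [Complex.cpow_def_of_ne_zero (ne hA), Complex.cpow_def_of_ne_zero (ne hB),
    Complex.cpow_def_of_ne_zero (ne hC), Complex.cpow_def_of_ne_zero (ne hD),
    Complex.cpow_def_of_ne_zero hr0, ← Complex.exp_add, ← Complex.exp_add, ← Complex.exp_add,
    ← add_mul, ← add_mul, ← add_mul, sub_eq_zero.1 hlog]

/-! ### Transformation and rigidity of the kernel -/

section Kernel

variable {E : Type*} [NormedAddCommGroup E]

lemma UnitBall.norm_lt_one (z : UnitBall E) : ‖(z : E)‖ < 1 := mem_ball_zero_iff.1 z.2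

variable [InnerProductSpace ℂ E] (γ : Set.Ioi (0 : ℝ))

lemma gammaKernel_ne_zero (z w : UnitBall E) : gammaKernel γ z w ≠ 0 := by
  rw [gammaKernel, one_div, ne_eq, inv_eq_zero, Complex.cpow_eq_zero_iff]
  exact fun h => one_sub_inner_ne_zero z.norm_lt_one w.norm_lt_one h.1

lemma gammaKernel_origin_right (z : UnitBall E) :
    gammaKernel γ z (UnitBall.origin E) = 1 := by
  simp [gammaKernel, UnitBall.origin]

lemma conj_gammaKernel (z w : UnitBall E) : conj (gammaKernel γ z w) = gammaKernel γ w z :=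
  (gammaKernel_posSemidef (E := E) γ).1.apply w z

lemma gammaKernel_self (a : UnitBall E) :
    gammaKernel γ a a = 1 / (((ballDefect (a : E) ^ 2 : ℝ) : ℂ) ^ ((γ : ℝ) : ℂ)) := by
  rw [gammaKernel, inner_self_eq_one_sub_ballDefect_sq a.norm_lt_one]
  simp

/-- `K(a,a)` is a positive real, so its principal power `1/2` is the ordinary square root. -/
lemma exists_sqrt_gammaKernel_self (a : UnitBall E) :
    ∃ k : ℝ, 0 < k ∧ gammaKernel γ a a = (k : ℂ) ^ 2 ∧ gammaKernel γ a a ^ (1 / 2 : ℂ) = k := by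
  have hs : 0 < ballDefect (a : E) ^ 2 := pow_pos (ballDefect_pos a.norm_lt_one) 2
  set κ : ℝ := 1 / (ballDefect (a : E) ^ 2) ^ (γ : ℝ) with hκ
  have hκ0 : 0 < κ := by positivity
  have h : gammaKernel γ a a = (κ : ℂ) := by
    rw [gammaKernel_self, ← Complex.ofReal_cpow hs.le, hκ]
    simp
  refine ⟨√κ, Real.sqrt_pos.2 hκ0, ?_, ?_⟩
  · rw [h, ← Complex.ofReal_pow, Real.sq_sqrt hκ0.le]
  · rw [h, Real.sqrt_eq_rpow, Complex.ofReal_cpow hκ0.le]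
    simp

/-- The normalised kernel function `K(z, a) / K(a, a) ^ (1 / 2)`. -/
noncomputable def normalizedKernel (a z : UnitBall E) : ℂ :=
  gammaKernel γ z a / gammaKernel γ a a ^ (1 / 2 : ℂ)

lemma normalizedKernel_ne_zero (a z : UnitBall E) : normalizedKernel γ a z ≠ 0 := by
  obtain ⟨k, hk, -, h2⟩ := exists_sqrt_gammaKernel_self γ a
  rw [normalizedKernel, h2]
  exact div_ne_zero (gammaKernel_ne_zero γ z a) (by exact_mod_cast hk.ne')

/-- The `γ`-th power of the Möbius identity, inverted. Leaving `z'` and `w'` free lets it serve both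
the involutions and general automorphisms. -/
lemma gammaKernel_eq_of_one_sub_inner {a z w z' w' : UnitBall E}
    (h : (1 - ⟪(w' : E), z'⟫_ℂ) * (1 - ⟪(a : E), z⟫_ℂ) * (1 - ⟪(w : E), a⟫_ℂ) =
      (ballDefect (a : E) : ℂ) ^ 2 * (1 - ⟪(w : E), z⟫_ℂ)) :
    gammaKernel γ z w =
      normalizedKernel γ a z * conj (normalizedKernel γ a w) * gammaKernel γ z' w' := by
  have hs : 0 < ballDefect (a : E) ^ 2 := pow_pos (ballDefect_pos a.norm_lt_one) 2
  obtain ⟨k, hk, h1, h2⟩ := exists_sqrt_gammaKernel_self γ a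
  have hk0 : (k : ℂ) ≠ 0 := by exact_mod_cast hk.ne'
  have hpow := Complex.cpow_mul_cpow_mul_cpow_eq
    (re_one_sub_inner_pos z'.norm_lt_one w'.norm_lt_one)
    (re_one_sub_inner_pos z.norm_lt_one a.norm_lt_one)
    (re_one_sub_inner_pos a.norm_lt_one w.norm_lt_one)
    (re_one_sub_inner_pos z.norm_lt_one w.norm_lt_one) hs (by rw [h]; simp) ((γ : ℝ) : ℂ)
  have hK : gammaKernel γ z' w' * gammaKernel γ z a * gammaKernel γ a w =
      (k : ℂ) ^ 2 * gammaKernel γ z w := by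
    rw [← h1, gammaKernel_self]
    simp only [gammaKernel]
    rw [one_div_mul_one_div, one_div_mul_one_div, one_div_mul_one_div, hpow]
  rw [normalizedKernel, normalizedKernel, h2, map_div₀, conj_gammaKernel, Complex.conj_ofReal]
  field_simp
  linear_combination -hK

lemma gammaKernel_mobiusPerm (a z w : UnitBall E) :
    gammaKernel γ z w = normalizedKernel γ a z * conj (normalizedKernel γ a w) *
      gammaKernel γ (mobiusPerm a z) (mobiusPerm a w) :=
  gammaKernel_eq_of_one_sub_inner γ
    (one_sub_inner_ballMobius a.norm_lt_one z.norm_lt_one w.norm_lt_one)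

lemma gammaKernel_biholAut {Φ : UnitBall E ≃ UnitBall E} (hΦ : Φ ∈ biholAut E)
    (z w : UnitBall E) :
    gammaKernel γ z w = normalizedKernel γ (Φ.symm (UnitBall.origin E)) z *
      conj (normalizedKernel γ (Φ.symm (UnitBall.origin E)) w) * gammaKernel γ (Φ z) (Φ w) := by
  set a := Φ.symm (UnitBall.origin E) with ha
  -- Cartan's theorem applied to this map at the Möbius images of `z` and `w` gives `Φ` the same
  -- inner products as the involution.
  have hΨ : (mobiusPerm a).trans Φ ∈ biholAut E := by
    refine ⟨hΦ.1.comp (isHolomorphicSelfMap_mobiusPerm a), ?_⟩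
    have := (isHolomorphicSelfMap_mobiusPerm a).comp hΦ.2
    rwa [← mobiusPerm_symm a] at this
  have h0 : (mobiusPerm a).trans Φ (UnitBall.origin E) = UnitBall.origin E := by
    simp [mobiusPerm_origin, ha]
  have hin := inner_map_of_mem_biholAut hΨ h0 (mobiusPerm a z) (mobiusPerm a w)
  simp only [Equiv.trans_apply, mobiusPerm_mobiusPerm] at hin
  refine gammaKernel_eq_of_one_sub_inner γ ?_
  rw [hin]
  exact one_sub_inner_ballMobius a.norm_lt_one z.norm_lt_one w.norm_lt_one

/-- Since `γ` is real, `|x^γ| = |x|^γ`: moduli are recovered without any choice of branch. -/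
lemma norm_one_sub_inner_eq_of_gammaKernel_eq {z w z' w' : UnitBall E}
    (h : gammaKernel γ z' w' = gammaKernel γ z w) :
    ‖1 - ⟪(w' : E), z'⟫_ℂ‖ = ‖1 - ⟪(w : E), z⟫_ℂ‖ := by
  have hγ : (0 : ℝ) < γ := γ.2
  rw [gammaKernel, gammaKernel, one_div, one_div, inv_inj] at h
  have h1 := congrArg norm h
  rw [Complex.norm_cpow_real, Complex.norm_cpow_real] at h1
  exact (Real.rpow_left_inj (norm_nonneg _) (norm_nonneg _) hγ.ne').1 h1

lemma norm_eq_of_gammaKernel_self_eq {z z' : UnitBall E}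
    (h : gammaKernel γ z' z' = gammaKernel γ z z) : ‖(z' : E)‖ = ‖(z : E)‖ := by
  have h1 := norm_one_sub_inner_eq_of_gammaKernel_eq γ h
  have key : ∀ x : UnitBall E, ‖1 - ⟪(x : E), x⟫_ℂ‖ = 1 - ‖(x : E)‖ ^ 2 := fun x => by
    have hx := x.norm_lt_one
    rw [inner_self_eq_norm_sq_to_K]
    have e : (1 : ℂ) - ((‖(x : E)‖ : ℝ) : ℂ) ^ 2 = ((1 - ‖(x : E)‖ ^ 2 : ℝ) : ℂ) := by simp
    refine (congrArg norm e).trans ?_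
    rw [Complex.norm_real, Real.norm_of_nonneg]
    nlinarith [norm_nonneg (x : E)]
  rw [key, key] at h1
  exact (sq_eq_sq₀ (norm_nonneg _) (norm_nonneg _)).1 (by linarith)

/-- Norms are preserved, and `1 - Re ⟨ψ z, ψ w⟩ ≤ |1 - ⟨z,w⟩|`; expanding `‖ψ w - ψ z‖²` bounds it
by a continuous function of `w` vanishing at `w = z`. -/
lemma continuous_of_gammaKernel_map {ψ : UnitBall E → UnitBall E}
    (h : ∀ z w, gammaKernel γ (ψ z) (ψ w) = gammaKernel γ z w) : Continuous ψ := by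
  rw [continuous_iff_continuousAt]
  intro z
  have hn : ∀ w, ‖(ψ w : E)‖ = ‖(w : E)‖ := fun w => norm_eq_of_gammaKernel_self_eq γ (h w w)
  have hb : ∀ w, ‖(ψ w : E) - ψ z‖ ^ 2 ≤
      ‖(z : E)‖ ^ 2 + ‖(w : E)‖ ^ 2 - 2 + 2 * ‖1 - ⟪(w : E), z⟫_ℂ‖ := by
    intro w
    have h1 := norm_one_sub_inner_eq_of_gammaKernel_eq γ (h z w)
    have h2 := Complex.re_le_norm (1 - ⟪(ψ w : E), ψ z⟫_ℂ)
    rw [h1, Complex.sub_re, Complex.one_re] at h2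
    have h3 := norm_sub_sq (𝕜 := ℂ) (ψ w : E) (ψ z)
    rw [hn, hn, RCLike.re_eq_complex_re] at h3
    linarith
  have hz0 : ‖(z : E)‖ ^ 2 + ‖(z : E)‖ ^ 2 - 2 + 2 * ‖1 - ⟪(z : E), z⟫_ℂ‖ = 0 := by
    have hx := z.norm_lt_one
    have e : (1 : ℂ) - ⟪(z : E), z⟫_ℂ = ((1 - ‖(z : E)‖ ^ 2 : ℝ) : ℂ) := by
      rw [inner_self_eq_norm_sq_to_K]; simp
    rw [e, Complex.norm_real, Real.norm_of_nonneg (by nlinarith [norm_nonneg (z : E)])]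
    ring
  have hcont : Continuous fun w : UnitBall E =>
      ‖(z : E)‖ ^ 2 + ‖(w : E)‖ ^ 2 - 2 + 2 * ‖1 - ⟪(w : E), z⟫_ℂ‖ := by fun_prop
  have ht := hcont.tendsto z
  simp only [hz0] at ht
  have hsq : Filter.Tendsto (fun w => ‖(ψ w : E) - ψ z‖ ^ 2) (nhds z) (nhds 0) :=
    squeeze_zero (fun _ => sq_nonneg _) hb ht
  have hsqrt := hsq.sqrt
  simp only [Real.sqrt_zero, Real.sqrt_sq (norm_nonneg _)] at hsqrt
  rw [ContinuousAt, tendsto_iff_dist_tendsto_zero]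
  refine hsqrt.congr fun w => ?_
  rw [Subtype.dist_eq, dist_eq_norm]

/-- A map preserving the kernel preserves inner products. -/
lemma inner_map_of_gammaKernel_map {ψ : UnitBall E → UnitBall E}
    (h : ∀ z w, gammaKernel γ (ψ z) (ψ w) = gammaKernel γ z w)
    (z w : UnitBall E) : ⟪(ψ w : E), ψ z⟫_ℂ = ⟪(w : E), z⟫_ℂ := by
  have hγ : (γ : ℝ) ≠ 0 := ne_of_gt γ.2
  have hcψ := continuous_of_gammaKernel_map γ h
  -- For large `γ` the power is not injective on the half-plane. But `f` is continuous with values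
  -- in `2πiℤ` and vanishes at the centre, so it vanishes on the connected ball.
  let f : UnitBall E → ℂ := fun w =>
    Complex.log (1 - ⟪(ψ w : E), ψ z⟫_ℂ) * ((γ : ℝ) : ℂ) -
      Complex.log (1 - ⟪(w : E), z⟫_ℂ) * ((γ : ℝ) : ℂ)
  have hf : Continuous f := by
    refine Continuous.sub ?_ ?_ <;> refine (Continuous.clog (by fun_prop) fun w => ?_).mul_const _
    · exact Or.inl (re_one_sub_inner_pos (ψ z).norm_lt_one (ψ w).norm_lt_one)
    · exact Or.inl (re_one_sub_inner_pos z.norm_lt_one w.norm_lt_one)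
  have hexp : ∀ w, Complex.exp (f w) = 1 := by
    intro w
    have h1 := h z w
    rw [gammaKernel, gammaKernel, one_div, one_div, inv_inj] at h1
    rw [Complex.exp_sub,
      ← Complex.cpow_def_of_ne_zero (one_sub_inner_ne_zero (ψ z).norm_lt_one (ψ w).norm_lt_one),
      ← Complex.cpow_def_of_ne_zero (one_sub_inner_ne_zero z.norm_lt_one w.norm_lt_one), h1]
    exact div_self ((Complex.cpow_eq_zero_iff _ _).not.2 fun hc =>
      one_sub_inner_ne_zero z.norm_lt_one w.norm_lt_one hc.1)
  have h0 : f (UnitBall.origin E) = 0 := by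
    have : (ψ (UnitBall.origin E) : E) = 0 := by
      rw [← norm_eq_zero, norm_eq_of_gammaKernel_self_eq γ (h _ _)]
      simp [UnitBall.origin]
    have h1 : ((UnitBall.origin E : UnitBall E) : E) = 0 := rfl
    simp [f, this, h1]
  -- Discreteness of `2πiℤ` makes the zero set open as well as closed.
  have hset : {w | f w = 0} = {w | |(f w).im| < 2 * Real.pi} := by
    ext w
    refine ⟨fun hw => ?_, fun hw => Complex.eq_zero_of_exp_eq_one_of_abs_im_lt (hexp w) hw⟩
    simp only [Set.mem_ofPred_eq] at hw ⊢
    rw [hw]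
    simpa using Real.two_pi_pos
  have hclopen : IsClopen {w | f w = 0} := by
    refine ⟨isClosed_eq hf continuous_const, ?_⟩
    rw [hset]
    exact isOpen_lt (by fun_prop) continuous_const
  have : PreconnectedSpace (UnitBall E) := by
    let _ : NormedSpace ℝ E := NormedSpace.complexToReal
    exact isPreconnected_iff_preconnectedSpace.1 (convex_ball (0 : E) 1).isPreconnected
  have huniv := hclopen.eq_univ ⟨_, h0⟩
  have hw : f w = 0 := by
    have := Set.mem_univ w
    rwa [← huniv] at this
  have hlog := mul_right_cancel₀ (Complex.ofReal_ne_zero.2 hγ) (sub_eq_zero.1 hw)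
  have := congrArg Complex.exp hlog
  rw [Complex.exp_log (one_sub_inner_ne_zero (ψ z).norm_lt_one (ψ w).norm_lt_one),
    Complex.exp_log (one_sub_inner_ne_zero z.norm_lt_one w.norm_lt_one)] at this
  linear_combination -this

end Kernel

/-! ### The two implications -/

section Main

variable {E : Type*} [NormedAddCommGroup E] [InnerProductSpace ℂ E] {γ : Set.Ioi (0 : ℝ)}

lemma exists_smul_mem_ball (x : E) : ∃ c : ℂ, c ≠ 0 ∧ c • x ∈ Metric.ball (0 : E) 1 := by
  have hp : (0 : ℝ) < 1 + ‖x‖ := by positivity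
  refine ⟨((1 + ‖x‖)⁻¹ : ℝ), by exact_mod_cast (inv_pos.2 hp).ne', ?_⟩
  rw [mem_ball_zero_iff, norm_smul, Complex.norm_real, Real.norm_of_nonneg (inv_pos.2 hp).le,
    inv_mul_lt_one₀ hp]
  linarith

lemma eq_zero_of_forall_ball_inner_eq_zero (x : E) (h : ∀ z : UnitBall E, ⟪(z : E), x⟫_ℂ = 0) :
    x = 0 := by
  obtain ⟨c, hc, hcx⟩ := exists_smul_mem_ball x
  have := h ⟨_, hcx⟩
  rw [inner_smul_left] at this
  simpa [hc] using this

lemma kernel_HGamma (z w : UnitBall E) :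
    RKHS.kernel (HGamma E γ) z w 1 = gammaKernel γ z w := by
  rw [RKHS.OfKernel.kernel_ofKernel]
  simp [gammaMatrix]

lemma isHolomorphicSelfMap_of_linear {φ : UnitBall E → UnitBall E} (U : E →L[ℂ] E)
    (h : ∀ z : UnitBall E, (φ z : E) = U z) : IsHolomorphicSelfMap φ :=
  ⟨U, U.differentiable.differentiableOn, fun z => (h z).symm⟩

/-- The restriction of a unitary to the unit ball. -/
def LinearIsometryEquiv.ballPerm (U : E ≃ₗᵢ[ℂ] E) : UnitBall E ≃ UnitBall E where
  toFun z := ⟨U z, mem_ball_zero_iff.2 ((U.norm_map z).trans_lt z.norm_lt_one)⟩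
  invFun z := ⟨U.symm z, mem_ball_zero_iff.2 ((U.symm.norm_map z).trans_lt z.norm_lt_one)⟩
  left_inv z := by simp
  right_inv z := by simp

lemma LinearIsometryEquiv.ballPerm_mem_biholAut (U : E ≃ₗᵢ[ℂ] E) : U.ballPerm ∈ biholAut E :=
  ⟨isHolomorphicSelfMap_of_linear (U : E →L[ℂ] E) fun _ => rfl,
    isHolomorphicSelfMap_of_linear (U.symm : E →L[ℂ] E) fun _ => rfl⟩

lemma trans_mobiusPerm_mem_biholAut {Φ : UnitBall E ≃ UnitBall E} (hΦ : Φ ∈ biholAut E)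
    (b : UnitBall E) : Φ.trans (mobiusPerm b) ∈ biholAut E := by
  refine ⟨(isHolomorphicSelfMap_mobiusPerm b).comp hΦ.1, ?_⟩
  rw [Equiv.symm_trans, mobiusPerm_symm]
  exact hΦ.2.comp (isHolomorphicSelfMap_mobiusPerm b)

theorem isUnitaryWCO_of_mem_biholAut {Φ : UnitBall E ≃ UnitBall E} (hΦ : Φ ∈ biholAut E)
    {μ : ℂ} (hμ : ‖μ‖ = 1) :
    IsUnitaryWCO (HGamma E γ)
      (fun z => μ * normalizedKernel γ (Φ.symm (UnitBall.origin E)) z) Φ := by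
  have hμ0 : μ ≠ 0 := by
    rintro rfl
    simp at hμ
  have hμμ : μ * conj μ = 1 := by rw [Complex.mul_conj, Complex.normSq_eq_norm_sq, hμ]; simp
  refine isUnitaryWCO_of_kernel_eq Φ.surjective
    (fun z => mul_ne_zero hμ0 (normalizedKernel_ne_zero γ _ z)) fun z w => ?_
  rw [kernel_HGamma, kernel_HGamma, gammaKernel_biholAut γ hΦ z w, map_mul]
  linear_combination (-(normalizedKernel γ (Φ.symm (UnitBall.origin E)) z *
    conj (normalizedKernel γ (Φ.symm (UnitBall.origin E)) w) * gammaKernel γ (Φ z) (Φ w))) * hμμ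

theorem exists_biholAut_of_isUnitaryWCO [CompleteSpace E] {φ : UnitBall E → UnitBall E}
    {δ : UnitBall E → ℂ} (h : IsUnitaryWCO (HGamma E γ) δ φ) : ∃ Φ ∈ biholAut E, ⇑Φ = φ := by
  set b := φ (UnitBall.origin E) with hb
  let ψ : UnitBall E → UnitBall E := fun z => mobiusPerm b (φ z)
  have hK : ∀ z w, gammaKernel γ z w = δ z * conj (δ w) * gammaKernel γ (φ z) (φ w) :=
    fun z w => by simpa only [kernel_HGamma] using kernel_eq_of_isUnitaryWCO h z w
  -- The weight that accompanies `ψ` in the kernel identity.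
  let η : UnitBall E → ℂ := fun z => δ z * normalizedKernel γ b (φ z)
  have hη : ∀ z w, gammaKernel γ z w = η z * conj (η w) * gammaKernel γ (ψ z) (ψ w) :=
    fun z w => by
      rw [hK, gammaKernel_mobiusPerm γ b (φ z) (φ w)]
      simp only [η, ψ, map_mul]
      ring
  have hψ0 : ψ (UnitBall.origin E) = UnitBall.origin E := by simp only [ψ, ← hb, mobiusPerm_self]
  have hη1 : ∀ z, η z * conj (η (UnitBall.origin E)) = 1 := fun z => by
    have := hη z (UnitBall.origin E)
    rw [hψ0, gammaKernel_origin_right, gammaKernel_origin_right] at this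
    simpa using this.symm
  have hηc : ∀ z, η z = η (UnitBall.origin E) := fun z =>
    mul_right_cancel₀ (right_ne_zero_of_mul_eq_one (hη1 z)) ((hη1 z).trans (hη1 _).symm)
  have hψK : ∀ z w, gammaKernel γ (ψ z) (ψ w) = gammaKernel γ z w := fun z w => by
    rw [hη z w, hηc w, hη1, one_mul]
  have hin := inner_map_of_gammaKernel_map γ hψK
  -- An isometry need not be onto in infinite dimension; injectivity of `W` supplies totality of the
  -- range.
  have htot : ∀ x : E, (∀ z : UnitBall E, ⟪(ψ z : E), x⟫_ℂ = 0) → x = 0 := by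
    intro x hx
    obtain ⟨c, hc, hcx⟩ := exists_smul_mem_ball x
    let v : UnitBall E := ⟨c • x, hcx⟩
    have hv : ∀ z, gammaKernel γ (ψ z) v = 1 := fun z => by
      have : ⟪c • x, (ψ z : E)⟫_ℂ = 0 := by
        rw [← inner_conj_symm, inner_smul_right, hx]
        simp
      simp [gammaKernel, v, this]
    -- The kernel function at `u` transported by the Möbius involution, so that the values of `k u`
    -- along `φ` are nonzero multiples of `K(ψ z, u)`.
    let k : UnitBall E → HGamma E γ := fun u =>
      conj (normalizedKernel γ b u) • RKHS.kerFun (HGamma E γ) (mobiusPerm b u) (1 : ℂ)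
    have hk : ∀ u z, normalizedKernel γ b z * k u (mobiusPerm b z) = gammaKernel γ z u :=
      fun u z => by
        rw [gammaKernel_mobiusPerm γ b z u]
        simp only [k, RKHS.coe_smul, Pi.smul_apply, RKHS.kerFun_one_apply, kernel_HGamma,
          smul_eq_mul]
        ring
    -- Since `v` is orthogonal to the range of `ψ`, both `K(ψ z, v)` and `K(ψ z, 0)` equal `1`; the
    -- difference vanishes along `φ`.
    have hzero : k v - k (UnitBall.origin E) = 0 := by
      refine eq_zero_of_isUnitaryWCO h _ fun z => ?_
      refine (mul_eq_zero.1 ?_).resolve_left (normalizedKernel_ne_zero γ b (ψ z))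
      have hφ : φ z = mobiusPerm b (ψ z) := (mobiusPerm_mobiusPerm b (φ z)).symm
      rw [hφ, RKHS.coe_sub, Pi.sub_apply, mul_sub, hk, hk, hv, gammaKernel_origin_right, sub_self]
    -- Evaluating `k v = k 0` at the Möbius image of `v` gives `K(v,v) = K(v,0) = 1`, hence `v = 0`.
    have hvv : gammaKernel γ v v = gammaKernel γ (UnitBall.origin E) (UnitBall.origin E) := by
      rw [gammaKernel_origin_right, ← gammaKernel_origin_right γ v, ← hk v v,
        ← hk (UnitBall.origin E) v, sub_eq_zero.1 hzero]
    have := norm_eq_of_gammaKernel_self_eq γ hvv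
    simpa [v, UnitBall.origin, hc] using this
  obtain ⟨U, hU⟩ := exists_linearIsometryEquiv_of_gram_eq (fun z : UnitBall E => (z : E))
    (fun z => (ψ z : E)) eq_zero_of_forall_ball_inner_eq_zero htot fun z w => (hin w z).symm
  refine ⟨U.ballPerm.trans (mobiusPerm b),
    trans_mobiusPerm_mem_biholAut U.ballPerm_mem_biholAut b, funext fun z => ?_⟩
  have hz : U.ballPerm z = ψ z := Subtype.ext (hU z)
  rw [Equiv.trans_apply, hz]
  exact mobiusPerm_mobiusPerm b (φ z)

/-- As `φ a = 0`, the kernel identity at `w = a` reads `K(z,a) = δ(z) conj(δ(a))`. Its diagonal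
gives `|δ(a)| = K(a,a)^(1/2)`, so `μ = K(a,a)^(1/2) / conj(δ(a))` is unimodular. -/
theorem exists_weight_of_isUnitaryWCO {φ : UnitBall E → UnitBall E}
    {δ : UnitBall E → ℂ} (h : IsUnitaryWCO (HGamma E γ) δ φ) {a : UnitBall E}
    (ha : φ a = UnitBall.origin E) :
    ∃ μ : ℂ, ‖μ‖ = 1 ∧ ∀ z, δ z = μ * normalizedKernel γ a z := by
  have hK : ∀ z, gammaKernel γ z a = δ z * conj (δ a) := fun z => by
    have := kernel_eq_of_isUnitaryWCO h z a
    rw [kernel_HGamma, kernel_HGamma, ha, gammaKernel_origin_right] at this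
    simpa using this
  obtain ⟨k, hk, h1, h2⟩ := exists_sqrt_gammaKernel_self γ a
  have hk0 : (k : ℂ) ≠ 0 := by exact_mod_cast hk.ne'
  have haa := hK a
  have hδ : conj (δ a) ≠ 0 := right_ne_zero_of_mul (haa ▸ gammaKernel_ne_zero γ a a)
  have hnorm : ‖δ a‖ = k := by
    rw [h1, Complex.mul_conj, Complex.normSq_eq_norm_sq] at haa
    exact ((sq_eq_sq₀ hk.le (norm_nonneg _)).1 (by exact_mod_cast haa)).symm
  refine ⟨k / conj (δ a), ?_, fun z => ?_⟩
  · rw [norm_div, Complex.norm_real, Real.norm_of_nonneg hk.le, RCLike.norm_conj, hnorm,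
      div_self hk.ne']
  · rw [normalizedKernel, h2, hK]
    field_simp

end Main

theorem corollary4p2 (d : ℕ∞) (γ : Set.Ioi (0 : ℝ))
    (φ : UnitBall (CSpace d) → UnitBall (CSpace d)) (δ : UnitBall (CSpace d) → ℂ) :
    IsUnitaryWCO (HGamma (CSpace d) γ) δ φ ↔
      ∃ Φ ∈ biholAut (CSpace d), ⇑Φ = φ ∧ ∃ μ : ℂ, ‖μ‖ = 1 ∧
        let a := Φ.symm (UnitBall.origin (CSpace d))
        ∀ z, δ z = μ * (gammaKernel γ z a / gammaKernel γ a a ^ (1 / 2 : ℂ)) := by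
  constructor
  · intro h
    obtain ⟨Φ, hΦ, rfl⟩ := exists_biholAut_of_isUnitaryWCO h
    exact ⟨Φ, hΦ, rfl, exists_weight_of_isUnitaryWCO h (Φ.apply_symm_apply _)⟩
  · rintro ⟨Φ, hΦ, rfl, μ, hμ, h⟩
    rw [show δ = fun z => μ * normalizedKernel γ (Φ.symm (UnitBall.origin (CSpace d))) z from
      funext h]
    exact isUnitaryWCO_of_mem_biholAut hΦ hμ
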